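/- Let $N$ be a positive integer and let $(|j\rangle)_{j\in\mathbb{Z}_N}$ be the standard basis of $\mathbb{C}^N$. Put $\omega_N=e^{2\pi i/N}$, $\tau=-e^{\pi i/N}$, and let $Z_N|j\rangle=\omega_N^{j}|j\rangle$, $X_N|j\rangle=|j-1\rangle$, $W(k,\ell)=\tau^{k\ell}X_N^kZ_N^\ell$ for $k,\ell\in\mathbb{Z}$; up to a sign, $W(k,\ell)$ depends only on $(k,\ell)$ modulo $N$. Let $I(N)=\{\lambda I\mid\lambda\in \mathrm{U}(1)\}$, let $H(N)=\{\lambda W(k,\ell)\mid \lambda\in \mathrm{U}(1),\ 0\le k,\ell\le N-1\}$ be the Heisenberg group, and let $C(N)=\{U\in \mathrm{U}(N)\mid UH(N)U^{-1}=H(N)\}$ be the Clifford group. Put $\overline{H}(N)=H(N)/I(N)$ and $\overline{C}(N)=C(N)/I(N)$ (the projective Clifford group), and write $U\sim V$ if $U=\lambda V$ for some $\lambda\in \mathrm{U}(1)$. Let $\nu:\mathbb{Z}_N^2\to\overline{C}(N)$ be the homomorphism sending $u$ to the class of $W(u)$, and let $\overline{\pi}:\overline{C}(N)\to \mathrm{SL}(2,\mathbb{Z}_N)$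 be the homomorphism sending the class of $U$ to the unique matrix $A\in\mathrm{SL}(2,\mathbb{Z}_N)$ such that $UW(u)U^{-1}\sim W(Au)$ for all $u\in\mathbb{Z}_N^2$. For a short exact sequence of groups $1\to H\xrightarrow{i}G\xrightarrow{\pi}K\to1$, call $G$ a semidirect product corresponding to the sequence if there are a homomorphism $\varphi:K\to\mathrm{Aut}(H)$ and an isomorphism $\Phi:K\ltimes_\varphi H\to G$ with $\Phi(1,h)=i(h)$ and $\pi(\Phi(x,1))=x$ for all $h\in H$, $x\in K$; call the sequence right splitting if there is a homomorphism $\mu:K\to G$ with $\pi\circ\mu=\mathrm{id}_K$. Theorem. Let $N\equiv 0\pmod 4$. Then the image of $\nu$ is $\overline{H}(N)$, the sequence $$1\to\mathbb{Z}_N^2\xrightarrow{\ \nu\ }\overline{C}(N)\xrightarrow{\ \overline{\pi}\ }\mathrm{SL}(2,\mathbb{Z}_N)\to1$$ is exact, and $\overline{C}(N)$ is not a semidirect product corresponding to this sequence, nor to the sequence $$1\to\overline{H}(N)\to\overline{C}(N)\to\overline{C}(N)/\overline{H}(N)\to1$$ given by the inclusion and the quotient map. Moreover, neither of these two exact sequences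 is right splitting. -/

import Mathlib

namespace CliffordGroup

open scoped Matrix

section Operators

variable (N : ℕ) [NeZero N]

/-- The unitary group `U(N)`, acting on `ℂ^N` whose standard basis `|0⟩, …, |N-1⟩` is labelled
by `ℤ_N`. -/
abbrev UN : Type := Matrix.unitaryGroup (ZMod N) ℂ

/-- The scalar matrices `λ I` with `λ ∈ U(1)`, as a homomorphism `U(1) → U(N)`. -/
noncomputable def phase : Circle →* UN N where
  toFun z := ⟨Matrix.scalar (ZMod N) (z : ℂ), by
    rw [Matrix.mem_unitaryGroup_iff]
    ext i j
    by_cases h : i = j <;>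
      simp [Matrix.star_eq_conjTranspose, Matrix.one_apply, h, Complex.mul_conj]⟩
  map_one' := by ext i j; simp [Matrix.one_apply, Matrix.diagonal_apply]
  map_mul' a b := by
    apply Subtype.ext
    simp

/-- The clock operator `Z_N |j⟩ = ω_N ^ j |j⟩`, where `ω_N = exp (2πi/N)`: here
`ZMod.toCircle j = exp (2πi j/N)`. -/
noncomputable def clock : UN N :=
  ⟨Matrix.diagonal fun j : ZMod N => (ZMod.toCircle j : ℂ), by
    rw [Matrix.mem_unitaryGroup_iff]
    ext i j
    by_cases h : i = j <;>
      simp [Matrix.star_eq_conjTranspose, Matrix.one_apply, h, Complex.mul_conj]⟩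

/-- The shift operator `X_N |j⟩ = |j - 1⟩`: the entry in row `i` and column `j` is `1` if
`i = j - 1` and `0` otherwise. -/
noncomputable def shift : UN N :=
  ⟨Matrix.of fun i j : ZMod N => if i = j - 1 then (1 : ℂ) else 0, by
    rw [Matrix.mem_unitaryGroup_iff]
    ext i j
    rw [Matrix.mul_apply, Finset.sum_eq_single (i + 1)]
    · simp [Matrix.one_apply, eq_comm]
    · intro b _ hb
      have : i ≠ b - 1 := fun h => hb (by rw [h]; ring)
      simp [this]
    · simp⟩

/-- `τ = - exp (πi/N)`, a square root of `ω_N`. -/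
noncomputable def tau : Circle := -Circle.exp (Real.pi / N)

/-- The Weyl displacement operator `W(k, ℓ) = τ ^ (k ℓ) X_N ^ k Z_N ^ ℓ` for `k, ℓ ∈ ℤ`. -/
noncomputable def weyl (k l : ℤ) : UN N :=
  phase N (tau N ^ (k * l)) * shift N ^ k * clock N ^ l

/-- The Weyl operator `W(u)` at the point `u ∈ ℤ_N²` of the finite phase space, computed on the
representatives `0, …, N-1` of the coordinates (other representatives give the same operator
up to sign). -/
noncomputable def weylAt (u : Fin 2 → ZMod N) : UN N := weyl N ((u 0).val : ℤ) ((u 1).val : ℤ)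

/-- The group `I(N) = {λ I | λ ∈ U(1)}` of phases. -/
noncomputable def phases : Subgroup (UN N) := (phase N).range

variable {N} in
/-- The relation `U ∼ V` on `U(N)`: `U = λ V` for some `λ ∈ U(1)`. -/
def PhaseEquiv (U V : UN N) : Prop := ∃ z : Circle, U = phase N z * V

theorem phase_comm (z : Circle) (U : UN N) : phase N z * U = U * phase N z := by
  apply Subtype.ext
  change Matrix.scalar (ZMod N) (z : ℂ) * (U : Matrix (ZMod N) (ZMod N) ℂ) = _
  exact (Matrix.scalar_commute (z : ℂ) (fun _ => Commute.all _ _) _).eq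

instance phases_normal : (phases N).Normal := by
  refine ⟨fun n hn g => ?_⟩
  obtain ⟨z, rfl⟩ := hn
  rw [← phase_comm, mul_assoc, mul_inv_cancel, mul_one]
  exact ⟨z, rfl⟩

/-- The projection of `U(N)` onto `U(N)/I(N)`. -/
noncomputable abbrev toPU : UN N →* UN N ⧸ phases N := QuotientGroup.mk' (phases N)

theorem toPU_phase (z : Circle) : toPU N (phase N z) = 1 :=
  (QuotientGroup.eq_one_iff _).2 ⟨z, rfl⟩

theorem toPU_eq_iff (U V : UN N) : toPU N U = toPU N V ↔ PhaseEquiv U V := by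
  constructor
  · intro h
    obtain ⟨z, hz⟩ := QuotientGroup.eq.1 h.symm
    exact ⟨z, by rw [phase_comm, hz, mul_inv_cancel_left]⟩
  · rintro ⟨z, rfl⟩
    rw [map_mul, toPU_phase, one_mul]

theorem shift_mul_clock :
    shift N * clock N = phase N (ZMod.toCircle (1 : ZMod N)) * (clock N * shift N) := by
  apply Subtype.ext
  ext i j
  simp only [shift, clock, phase, Matrix.UnitaryGroup.mul_val, MonoidHom.coe_mk, OneHom.coe_mk,
    Matrix.scalar_apply, Matrix.diagonal_mul, Matrix.mul_diagonal, Matrix.of_apply]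
  by_cases h : i = j - 1
  · have hj : j = 1 + i := by rw [h]; ring
    subst hj
    simp [AddChar.map_add_eq_mul]
  · simp [h]

theorem clock_pow : clock N ^ N = 1 := by
  apply Subtype.ext
  have h : ∀ j : ZMod N, (ZMod.toCircle j) ^ N = 1 := fun j => by
    rw [← AddChar.map_nsmul_eq_pow, nsmul_eq_mul, ZMod.natCast_self, zero_mul,
      AddChar.map_zero_eq_one]
  have h' : ((fun j : ZMod N => (ZMod.toCircle j : ℂ)) ^ N) = fun _ => 1 := by
    funext j
    rw [Pi.pow_apply, ← Circle.coe_pow, h j, Circle.coe_one]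
  change (Matrix.diagonal fun j : ZMod N => (ZMod.toCircle j : ℂ)) ^ N = 1
  rw [Matrix.diagonal_pow, h', Matrix.diagonal_one]

theorem shift_pow_val (k : ℕ) : ((shift N ^ k : UN N) : Matrix (ZMod N) (ZMod N) ℂ) =
    Matrix.of fun i j : ZMod N => if i = j - k then (1 : ℂ) else 0 := by
  induction k with
  | zero => ext i j; simp [Matrix.one_apply]
  | succ k ih =>
    rw [pow_succ, Matrix.UnitaryGroup.mul_val, ih]
    ext i j
    rw [Matrix.mul_apply, Finset.sum_eq_single (j - 1)]
    · have : i = j - 1 - (k : ZMod N) ↔ i = j - ((k : ZMod N) + 1) := by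
        rw [sub_sub, add_comm]
      simp [shift, this]
    · intro b _ hb
      simp [shift, hb]
    · simp

theorem shift_pow : shift N ^ N = 1 := by
  apply Subtype.ext
  rw [shift_pow_val]
  ext i j
  simp [Matrix.one_apply]

theorem toPU_comm : Commute (toPU N (shift N)) (toPU N (clock N)) := by
  change _ * _ = _ * _
  rw [← map_mul, shift_mul_clock, map_mul, toPU_phase, one_mul, map_mul]

theorem toPU_weyl (k l : ℤ) :
    toPU N (weyl N k l) = toPU N (shift N) ^ k * toPU N (clock N) ^ l := by
  rw [weyl, map_mul, map_mul, toPU_phase, one_mul, map_zpow, map_zpow]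

theorem toPU_weyl_mul (k l k' l' : ℤ) :
    toPU N (weyl N k l) * toPU N (weyl N k' l') = toPU N (weyl N (k + k') (l + l')) := by
  simp only [toPU_weyl, zpow_add]
  have := ((toPU_comm N).zpow_zpow k' l).eq
  rw [mul_assoc, ← mul_assoc _ _ (toPU N (clock N) ^ l'), ← this]
  simp only [mul_assoc]

theorem toPU_weyl_congr {k l k' l' : ℤ} (hk : (k : ZMod N) = k') (hl : (l : ZMod N) = l') :
    toPU N (weyl N k l) = toPU N (weyl N k' l') := by
  obtain ⟨c, hc⟩ := (ZMod.intCast_eq_intCast_iff_dvd_sub _ _ _).1 hk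
  obtain ⟨d, hd⟩ := (ZMod.intCast_eq_intCast_iff_dvd_sub _ _ _).1 hl
  have e1 : k' = k + N * c := by omega
  have e2 : l' = l + N * d := by omega
  have hx : toPU N (shift N) ^ N = 1 := by rw [← map_pow, shift_pow, map_one]
  have hz : toPU N (clock N) ^ N = 1 := by rw [← map_pow, clock_pow, map_one]
  rw [toPU_weyl, toPU_weyl, e1, e2, zpow_add, zpow_add, zpow_mul, zpow_mul, zpow_natCast,
    zpow_natCast, hx, hz, one_zpow, one_zpow, mul_one, mul_one]

theorem toPU_weylAt_cast (k l : ℤ) :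
    toPU N (weylAt N ![(k : ZMod N), (l : ZMod N)]) = toPU N (weyl N k l) := by
  apply toPU_weyl_congr <;> simp

theorem toPU_weylAt_add (u v : Fin 2 → ZMod N) :
    toPU N (weylAt N (u + v)) = toPU N (weylAt N u) * toPU N (weylAt N v) := by
  rw [weylAt, weylAt, weylAt, toPU_weyl_mul]
  apply toPU_weyl_congr <;> simp

/-- The map `u ↦ W(u)` modulo phases, as a homomorphism. -/
noncomputable def weylPU : Multiplicative (Fin 2 → ZMod N) →* UN N ⧸ phases N :=
  MonoidHom.mk' (fun u => toPU N (weylAt N u.toAdd)) fun _ _ => toPU_weylAt_add N _ _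

/-! ### Heisenberg group -/

/-- The Heisenberg group `H(N) = {λ W(k, ℓ) | λ ∈ U(1), k, ℓ = 0, …, N-1}`. -/
noncomputable def heisenberg : Subgroup (UN N) where
  carrier := {U | ∃ (z : Circle) (u : Fin 2 → ZMod N), U = phase N z * weylAt N u}
  one_mem' := by
    refine (toPU_eq_iff N _ _).1 ?_ |>.elim fun z hz => ⟨z, 0, hz⟩
    exact (map_one (toPU N)).trans (map_one (weylPU N)).symm
  mul_mem' := by
    rintro _ _ ⟨z, u, rfl⟩ ⟨z', u', rfl⟩
    refine (toPU_eq_iff N _ _).1 ?_ |>.elim fun z hz => ⟨z, u + u', hz⟩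
    rw [toPU_weylAt_add, map_mul, map_mul, map_mul, toPU_phase, toPU_phase, one_mul, one_mul]
  inv_mem' := by
    rintro _ ⟨z, u, rfl⟩
    refine (toPU_eq_iff N _ _).1 ?_ |>.elim fun z hz => ⟨z, -u, hz⟩
    rw [map_inv, map_mul, toPU_phase, one_mul]
    exact (map_inv (weylPU N) (Multiplicative.ofAdd u)).symm

theorem mem_heisenberg_iff (U : UN N) :
    U ∈ heisenberg N ↔ ∃ u : Fin 2 → ZMod N, toPU N U = toPU N (weylAt N u) := by
  simp only [toPU_eq_iff]
  exact exists_comm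

theorem weyl_mem (k l : ℤ) : weyl N k l ∈ heisenberg N :=
  (mem_heisenberg_iff N _).2 ⟨_, (toPU_weylAt_cast N k l).symm⟩

theorem phases_le_heisenberg : phases N ≤ heisenberg N := by
  rintro _ ⟨z, rfl⟩
  refine (mem_heisenberg_iff N _).2 ⟨0, ?_⟩
  rw [toPU_phase]
  exact (map_one (weylPU N)).symm

/-! ### Clifford group -/

/-- The Clifford group `C(N) = {U ∈ U(N) | U H(N) U⁻¹ = H(N)}`. -/
noncomputable def clifford : Subgroup (UN N) := Subgroup.normalizer (heisenberg N : Set (UN N))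

theorem heisenberg_le_clifford : heisenberg N ≤ clifford N := Subgroup.le_normalizer

theorem conj_mem {U V : UN N} (hU : U ∈ clifford N) (hV : V ∈ heisenberg N) :
    U * V * U⁻¹ ∈ heisenberg N :=
  (Subgroup.mem_normalizer_iff.1 hU V).1 hV

/-- The projective Clifford group `C̄(N) = C(N)/I(N)`. -/
abbrev ProjClifford : Type := clifford N ⧸ (phases N).subgroupOf (clifford N)

/-- The projective Heisenberg group `H̄(N) = H(N)/I(N)`, as a subgroup of `C̄(N)`. -/
noncomputable def projHeisenberg : Subgroup (ProjClifford N) :=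
  ((heisenberg N).subgroupOf (clifford N)).map
    (QuotientGroup.mk' ((phases N).subgroupOf (clifford N)))

instance projHeisenberg_normal : (projHeisenberg N).Normal := by
  have : ((heisenberg N).subgroupOf (clifford N)).Normal := Subgroup.normal_in_normalizer
  exact this.map _ (QuotientGroup.mk'_surjective _)

theorem projClifford_mk_eq_iff (U V : clifford N) :
    (U : ProjClifford N) = V ↔ toPU N (U : UN N) = toPU N (V : UN N) := by
  rw [QuotientGroup.eq, Subgroup.mem_subgroupOf]
  exact QuotientGroup.eq.symm

/-- The homomorphism `ν : ℤ_N² → C̄(N)`, `u ↦ W(u)` modulo phases (the additive group `ℤ_N²` is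
written multiplicatively). -/
noncomputable def nu : Multiplicative (Fin 2 → ZMod N) →* ProjClifford N :=
  MonoidHom.mk' (fun u => ((⟨weylAt N u.toAdd,
      heisenberg_le_clifford N (weyl_mem N _ _)⟩ : clifford N) : ProjClifford N)) fun u v => by
    rw [← QuotientGroup.mk_mul, projClifford_mk_eq_iff]
    exact toPU_weylAt_add N _ _

/-! ### The action of the Clifford group on the phase space -/

/-- Commutation of powers in the presence of a central commutator. -/
theorem zpow_mul_zpow_of_central {G : Type*} [Group G] {x z c : G} (hc : ∀ g : G, c * g = g * c)
    (h : x * z = c * (z * x)) (k l : ℤ) : x ^ k * z ^ l = c ^ (k * l) * (z ^ l * x ^ k) := by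
  have key : ∀ (x z c : G), (∀ g : G, c * g = g * c) → x * z = c * (z * x) → ∀ l : ℤ,
      x * z ^ l = c ^ l * (z ^ l * x) := by
    intro x z c hc h l
    have h1 : MulAut.conj x z = c * z := by
      rw [MulAut.conj_apply, h, mul_assoc, mul_assoc, mul_inv_cancel, mul_one]
    have h2 : MulAut.conj x (z ^ l) = c ^ l * z ^ l := by
      rw [map_zpow, h1, Commute.mul_zpow (hc z)]
    rw [MulAut.conj_apply, mul_inv_eq_iff_eq_mul, mul_assoc] at h2
    exact h2
  have hcz : ∀ (m : ℤ) (g : G), c ^ m * g = g * c ^ m := fun m g =>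
    (Commute.zpow_left (hc g) m).eq
  have h3 := key x z c hc h l
  have h4 : z ^ l * x = (c ^ l)⁻¹ * (x * z ^ l) := by rw [h3, inv_mul_cancel_left]
  have h5 := key (z ^ l) x (c ^ l)⁻¹ (fun g => by
    rw [← zpow_neg]; exact hcz _ g) h4 k
  rw [h5, ← mul_assoc, inv_zpow, ← zpow_mul, mul_comm l k, mul_inv_cancel, one_mul]

theorem shift_zpow_mul_clock_zpow (k l : ℤ) : shift N ^ k * clock N ^ l =
    phase N (ZMod.toCircle ((k * l : ℤ) : ZMod N)) * (clock N ^ l * shift N ^ k) := by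
  rw [zpow_mul_zpow_of_central (phase_comm N _) (shift_mul_clock N) k l, ← map_zpow,
    ← AddChar.map_zsmul_eq_zpow, zsmul_one]

theorem phase_injective : Function.Injective (phase N) := by
  intro a b h
  have h1 := congrFun (congrFun (congrArg Subtype.val h) 0) 0
  exact Circle.ext (by simpa [phase] using h1)

/-- The commutator of two Weyl operators is given by the symplectic form. -/
theorem weyl_mul_weyl (k l k' l' : ℤ) : weyl N k l * weyl N k' l' =
    phase N (ZMod.toCircle ((k * l' - k' * l : ℤ) : ZMod N)) * (weyl N k' l' * weyl N k l) := by
  have hp : ∀ (z : Circle) (U V : UN N), U * (phase N z * V) = phase N z * (U * V) := by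
    intro z U V; rw [← mul_assoc, ← phase_comm, mul_assoc]
  have e : ∀ a b c d : ℤ, weyl N a b * weyl N c d =
      phase N (tau N ^ (a * b) * tau N ^ (c * d) * ZMod.toCircle ((- (c * b) : ℤ) : ZMod N)) *
        (shift N ^ (a + c) * clock N ^ (b + d)) := by
    intro a b c d
    have h1 : clock N ^ b * shift N ^ c =
        phase N (ZMod.toCircle ((- (c * b) : ℤ) : ZMod N)) * (shift N ^ c * clock N ^ b) := by
      rw [shift_zpow_mul_clock_zpow, ← mul_assoc, ← map_mul, ← AddChar.map_add_eq_mul]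
      simp
    calc weyl N a b * weyl N c d = phase N (tau N ^ (a * b)) * (shift N ^ a * (clock N ^ b *
          (phase N (tau N ^ (c * d)) * (shift N ^ c * clock N ^ d)))) := by
          simp only [weyl, mul_assoc]
      _ = phase N (tau N ^ (a * b)) * (phase N (tau N ^ (c * d)) * (shift N ^ a *
          ((clock N ^ b * shift N ^ c) * clock N ^ d))) := by
          rw [hp, hp, mul_assoc (clock N ^ b)]
      _ = _ := by
          rw [h1, mul_assoc (phase N _), hp (ZMod.toCircle _), zpow_add, zpow_add, map_mul, map_mul]
          simp only [mul_assoc]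
  rw [e, e, ← mul_assoc (phase N (ZMod.toCircle _)), ← map_mul (phase N), add_comm k' k, add_comm l' l]
  congr 2
  rw [mul_comm (tau N ^ (k' * l')), mul_left_comm, ← AddChar.map_add_eq_mul]
  congr 2
  push_cast
  ring

theorem weylAt_mul_weylAt (u v : Fin 2 → ZMod N) : weylAt N u * weylAt N v =
    phase N (ZMod.toCircle (u 0 * v 1 - v 0 * u 1)) * (weylAt N v * weylAt N u) := by
  rw [weylAt, weylAt, weyl_mul_weyl]
  simp

/-- If `U ∼ W(u)` and `V ∼ W(v)`, then the commutator of `U` and `V` is read off from `u`, `v`. -/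
theorem mul_comm_of_phaseEquiv {U V : UN N} {u v : Fin 2 → ZMod N}
    (hU : PhaseEquiv U (weylAt N u)) (hV : PhaseEquiv V (weylAt N v)) :
    U * V = phase N (ZMod.toCircle (u 0 * v 1 - v 0 * u 1)) * (V * U) := by
  obtain ⟨a, rfl⟩ := hU
  obtain ⟨b, rfl⟩ := hV
  have hp : ∀ (z : Circle) (U V : UN N), U * (phase N z * V) = phase N z * (U * V) := by
    intro z U V; rw [← mul_assoc, ← phase_comm, mul_assoc]
  rw [mul_assoc, hp, weylAt_mul_weylAt, mul_assoc (phase N b), hp (a) (weylAt N v)]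
  simp only [← mul_assoc, ← map_mul]
  congr 3
  rw [mul_comm a b, mul_comm (b * a), mul_assoc]

theorem weylAt_phaseEquiv_injective {u v : Fin 2 → ZMod N}
    (h : PhaseEquiv (weylAt N u) (weylAt N v)) : u = v := by
  have h0 : ∀ w : Fin 2 → ZMod N, u 0 * w 1 - w 0 * u 1 = v 0 * w 1 - w 0 * v 1 := by
    intro w
    have hw : PhaseEquiv (weylAt N w) (weylAt N w) := ⟨1, by simp⟩
    have e1 := mul_comm_of_phaseEquiv N h hw
    rw [weylAt_mul_weylAt] at e1
    exact ZMod.injective_toCircle (phase_injective N (mul_right_cancel e1))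
  funext i
  have a := h0 ![1, 0]
  have b := h0 ![0, 1]
  fin_cases i
  · simpa using b
  · simpa using a

theorem conj_weyl_exists (U : clifford N) (u : Fin 2 → ZMod N) : ∃ v : Fin 2 → ZMod N,
    PhaseEquiv ((U : UN N) * weylAt N u * (U : UN N)⁻¹) (weylAt N v) := by
  obtain ⟨z, v, h⟩ := conj_mem N U.2 (weyl_mem N ((u 0).val : ℤ) ((u 1).val : ℤ))
  exact ⟨v, z, h⟩

/-- For every `U ∈ C(N)` there is a unique `A ∈ SL(2, ℤ_N)` such that `U W(u) U⁻¹ ∼ W(A u)` for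
all `u ∈ ℤ_N²`. -/
theorem existsUnique_matrix (U : clifford N) : ∃! A : Matrix.SpecialLinearGroup (Fin 2) (ZMod N),
    ∀ u : Fin 2 → ZMod N,
      PhaseEquiv ((U : UN N) * weylAt N u * (U : UN N)⁻¹)
        (weylAt N ((A : Matrix (Fin 2) (Fin 2) (ZMod N)) *ᵥ u)) := by
  choose f hf using conj_weyl_exists N U
  have hadd : ∀ u v, f (u + v) = f u + f v := by
    intro u v
    apply weylAt_phaseEquiv_injective N
    rw [← toPU_eq_iff, toPU_weylAt_add, ← (toPU_eq_iff N _ _).2 (hf (u + v)),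
      ← (toPU_eq_iff N _ _).2 (hf u), ← (toPU_eq_iff N _ _).2 (hf v)]
    simp only [map_mul, map_inv, toPU_weylAt_add]
    group
  have hsymp : ∀ u v, f u 0 * f v 1 - f v 0 * f u 1 = u 0 * v 1 - v 0 * u 1 := by
    intro u v
    have e1 := mul_comm_of_phaseEquiv N (hf u) (hf v)
    have e2 : (U : UN N) * weylAt N u * (U : UN N)⁻¹ * ((U : UN N) * weylAt N v * (U : UN N)⁻¹) =
        phase N (ZMod.toCircle (u 0 * v 1 - v 0 * u 1)) *
          ((U : UN N) * weylAt N v * (U : UN N)⁻¹ * ((U : UN N) * weylAt N u * (U : UN N)⁻¹)) := by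
      have := congrArg (MulAut.conj (U : UN N)) (weylAt_mul_weylAt N u v)
      simp only [map_mul, MulAut.conj_apply] at this
      rw [this, ← phase_comm, mul_assoc (phase N _), mul_inv_cancel, mul_one]
    rw [e2] at e1
    exact (ZMod.injective_toCircle (phase_injective N (mul_right_cancel e1))).symm
  let F : (Fin 2 → ZMod N) →+ (Fin 2 → ZMod N) := AddMonoidHom.mk' f hadd
  let L : (Fin 2 → ZMod N) →ₗ[ZMod N] (Fin 2 → ZMod N) := F.toZModLinearMap N
  have hL : ∀ u, LinearMap.toMatrix' L *ᵥ u = f u := fun u => LinearMap.toMatrix'_mulVec L u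
  have hdet : (LinearMap.toMatrix' L).det = 1 := by
    have := hsymp (Pi.single 0 1) (Pi.single 1 1)
    rw [← hL, ← hL] at this
    rw [Matrix.det_fin_two]
    simp only [Matrix.mulVec_single_one, Matrix.col_apply] at this
    rw [this]
    simp
  refine ⟨⟨LinearMap.toMatrix' L, hdet⟩, fun u => ?_, fun B hB => ?_⟩
  · change PhaseEquiv _ (weylAt N (LinearMap.toMatrix' L *ᵥ u))
    rw [hL]
    exact hf u
  · apply Subtype.ext
    apply Matrix.ext_of_mulVec_single
    intro i
    change _ = LinearMap.toMatrix' L *ᵥ _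
    rw [hL]
    apply weylAt_phaseEquiv_injective N
    rw [← toPU_eq_iff, ← (toPU_eq_iff N _ _).2 (hB _), ← (toPU_eq_iff N _ _).2 (hf _)]

/-- The matrix `A ∈ SL(2, ℤ_N)` determined by `U W(u) U⁻¹ ∼ W(A u)` for all `u ∈ ℤ_N²`. -/
noncomputable def actionMatrix (U : clifford N) : Matrix.SpecialLinearGroup (Fin 2) (ZMod N) :=
  (existsUnique_matrix N U).choose

theorem actionMatrix_spec (U : clifford N) (u : Fin 2 → ZMod N) :
    PhaseEquiv ((U : UN N) * weylAt N u * (U : UN N)⁻¹)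
      (weylAt N ((actionMatrix N U : Matrix (Fin 2) (Fin 2) (ZMod N)) *ᵥ u)) :=
  (existsUnique_matrix N U).choose_spec.1 u

/-- The homomorphism `π : C(N) → SL(2, ℤ_N)`, `U ↦ A`. -/
noncomputable def cliffordToSL : clifford N →* Matrix.SpecialLinearGroup (Fin 2) (ZMod N) :=
  MonoidHom.mk' (actionMatrix N) fun U V => by
    refine (existsUnique_matrix N (U * V)).unique (actionMatrix_spec N (U * V)) fun u => ?_
    change PhaseEquiv _ (weylAt N (((actionMatrix N U).1 * (actionMatrix N V).1) *ᵥ u))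
    rw [← Matrix.mulVec_mulVec, ← toPU_eq_iff]
    have e1 := (toPU_eq_iff N _ _).2 (actionMatrix_spec N V u)
    have e2 := (toPU_eq_iff N _ _).2
      (actionMatrix_spec N U ((actionMatrix N V).1 *ᵥ u))
    refine Eq.trans ?_ e2
    rw [map_mul (toPU N), map_mul (toPU N) _ (weylAt N _)]
    refine Eq.trans ?_ (congrArg (fun y => toPU N (U : UN N) * y * toPU N (U : UN N)⁻¹) e1)
    simp only [← map_mul, Subgroup.coe_mul, mul_inv_rev, mul_assoc]

/-- The homomorphism `π̄ : C̄(N) → SL(2, ℤ_N)` which sends the class of `U ∈ C(N)` to the unique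
`A` such that `U W(u) U⁻¹ ∼ W(A u)` for all `u ∈ ℤ_N²`. -/
noncomputable def piBar : ProjClifford N →* Matrix.SpecialLinearGroup (Fin 2) (ZMod N) :=
  QuotientGroup.lift ((phases N).subgroupOf (clifford N)) (cliffordToSL N) fun U hU => by
    refine (existsUnique_matrix N U).unique (actionMatrix_spec N U) fun u => ?_
    obtain ⟨z, hz⟩ := hU
    change phase N z = U at hz
    change PhaseEquiv _ (weylAt N ((1 : Matrix (Fin 2) (Fin 2) (ZMod N)) *ᵥ u))
    rw [Matrix.one_mulVec, ← hz, phase_comm, mul_assoc,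
      mul_inv_cancel, mul_one]
    exact ⟨1, by simp⟩

/-- The exact sequence `1 → H̄(N) → C̄(N) → C̄(N)/H̄(N) → 1`. -/
noncomputable def quotientExtension :
    GroupExtension (projHeisenberg N) (ProjClifford N) (ProjClifford N ⧸ projHeisenberg N) where
  inl := (projHeisenberg N).subtype
  rightHom := QuotientGroup.mk' (projHeisenberg N)
  inl_injective := Subtype.coe_injective
  range_inl_eq_ker_rightHom := by rw [Subgroup.range_subtype, QuotientGroup.ker_mk']
  rightHom_surjective := QuotientGroup.mk'_surjective _

end Operators

/-- `G` is a semidirect product corresponding to the exact sequence `1 → H → G → K → 1` (with maps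
`i` and `π`): there are `φ : K → Aut H` and an isomorphism `Φ` from the outer semidirect product to
`G` with `Φ (h, 1) = i h` and `π (Φ (1, x)) = x`. -/
def IsSemidirectFor {H G K : Type*} [Group H] [Group G] [Group K] (S : GroupExtension H G K) :
    Prop :=
  ∃ (φ : K →* MulAut H) (Φ : H ⋊[φ] K ≃* G),
    (∀ h : H, Φ (SemidirectProduct.inl h) = S.inl h) ∧
      ∀ x : K, S.rightHom (Φ (SemidirectProduct.inr x)) = x

/-- The exact sequence `1 → H → G → K → 1` is right splitting: there is a homomorphism
`μ : K → G` with `π ∘ μ = id`. -/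
def IsRightSplitting {H G K : Type*} [Group H] [Group G] [Group K] (S : GroupExtension H G K) :
    Prop :=
  ∃ μ : K →* G, S.rightHom.comp μ = MonoidHom.id K

end CliffordGroup

/-!
The two sequences have the same quotient: the image of `ν` is `H̄(N)`, and it is the kernel of `π̄`,
because a unitary which fixes `X` and `Z` modulo phases becomes central after multiplication by a
Weyl operator, and a unitary commuting with `X` and `Z` is a phase (`mem_phases_of_commute`,
`range_nu_eq_ker_piBar`). A semidirect product decomposition gives a splitting, so both sequences
are settled once `π̄` is known to be surjective and to have no homomorphic section.

Surjectivity: `SL(2, ℤ_N)` is generated by the quarter turn and by `T = (1, 0; 1, 1)`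
(`eq_top_of_rotSL_mem_of_lowerSL_mem`). The discrete Fourier transform lies over the first, and,
for even `N`, the diagonal operator `D = diag (exp (-πi j²/N))` over the second.

No section: write `D` and `P` for the classes in `C̄(N)` of the diagonal operator and of the parity
operator `|j⟩ ↦ |-j⟩`, which lies over `-1`. They commute, while `D ^ N = ν (0, N/2)`. A section
sends `T` to `ν u * D` and `-1` to `ν w * P` for some `u`, `w`. As `T` and `-1` commute,
`2 u₀ = 0`. As `T ^ N = 1`, the translation part `N/2 + (N choose 2) u₀` of the second coordinate
of `(ν u * D) ^ N` vanishes. When `4 ∣ N`, the number `N choose 2` is even, so that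
`(N choose 2) u₀ = 0` and then `N/2 = 0` in `ℤ_N`, which is absurd.
-/

namespace CliffordGroup

open scoped Matrix

section

variable (N : ℕ) [NeZero N]

/-! ### The action of Clifford operators on the phase space -/

theorem conj_toPU_weylAt {U : UN N} {A : Matrix.SpecialLinearGroup (Fin 2) (ZMod N)}
    {a b c d : ℤ} (hA : A.1 = !![(a : ZMod N), b; c, d])
    (hX : toPU N U * toPU N (shift N) =
      toPU N (shift N) ^ a * toPU N (clock N) ^ c * toPU N U)
    (hZ : toPU N U * toPU N (clock N) =
      toPU N (shift N) ^ b * toPU N (clock N) ^ d * toPU N U) (u : Fin 2 → ZMod N) :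
    toPU N (U * weylAt N u * U⁻¹) = toPU N (weylAt N (A.1 *ᵥ u)) := by
  have hX' : MulAut.conj (toPU N U) (toPU N (shift N)) = toPU N (weyl N a c) := by
    rw [MulAut.conj_apply, hX, mul_inv_cancel_right, toPU_weyl]
  have hZ' : MulAut.conj (toPU N U) (toPU N (clock N)) = toPU N (weyl N b d) := by
    rw [MulAut.conj_apply, hZ, mul_inv_cancel_right, toPU_weyl]
  have key : ∀ k l m : ℤ, toPU N (weyl N k l) ^ m = toPU N (weyl N (k * m) (l * m)) := by
    intro k l m
    rw [toPU_weyl, toPU_weyl, ((toPU_comm N).zpow_zpow k l).mul_zpow, zpow_mul, zpow_mul]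
  calc toPU N (U * weylAt N u * U⁻¹) = MulAut.conj (toPU N U) (toPU N (weylAt N u)) := by
        simp [MulAut.conj_apply]
    _ = toPU N (weylAt N (A.1 *ᵥ u)) := by
        rw [weylAt, toPU_weyl, map_mul, map_zpow, map_zpow, hX', hZ', key, key, toPU_weyl_mul,
          weylAt]
        apply toPU_weyl_congr <;> simp [hA, Matrix.mulVec, dotProduct, Fin.sum_univ_two]

/-- A unitary which acts on the two generators `X`, `Z` of the Heisenberg group, modulo phases,
through an integer matrix representing `A ∈ SL(2, ℤ_N)` is a Clifford operator over `A`. -/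
theorem exists_clifford_of_generators {U : UN N} {A : Matrix.SpecialLinearGroup (Fin 2) (ZMod N)}
    {a b c d : ℤ} (hA : A.1 = !![(a : ZMod N), b; c, d])
    (hX : toPU N U * toPU N (shift N) =
      toPU N (shift N) ^ a * toPU N (clock N) ^ c * toPU N U)
    (hZ : toPU N U * toPU N (clock N) =
      toPU N (shift N) ^ b * toPU N (clock N) ^ d * toPU N U) :
    ∃ h : U ∈ clifford N, cliffordToSL N ⟨U, h⟩ = A := by
  have hU := conj_toPU_weylAt N hA hX hZ
  refine ⟨?_, ?_⟩
  · refine Subgroup.mem_normalizer_iff.2 fun V => ?_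
    simp only [mem_heisenberg_iff]
    constructor
    · rintro ⟨u, hu⟩
      exact ⟨A.1 *ᵥ u, by rw [← hU, map_mul, map_mul, hu, map_mul, map_mul]⟩
    · rintro ⟨v, hv⟩
      refine ⟨A⁻¹.1 *ᵥ v, ?_⟩
      have h1 := hU (A⁻¹.1 *ᵥ v)
      have h2 : A.1 * A⁻¹.1 = 1 := congrArg Subtype.val (mul_inv_cancel A)
      rw [Matrix.mulVec_mulVec, h2, Matrix.one_mulVec, ← hv] at h1
      simpa using h1.symm
  · exact (existsUnique_matrix N _).unique (actionMatrix_spec N _) fun u =>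
      (toPU_eq_iff N _ _).1 (hU u)

theorem piBar_mk (U : clifford N) : piBar N (U : ProjClifford N) = cliffordToSL N U := rfl

theorem toPU_conj_weylAt (U : clifford N) (u : Fin 2 → ZMod N) :
    toPU N (U * weylAt N u * (U : UN N)⁻¹) = toPU N (weylAt N ((cliffordToSL N U).1 *ᵥ u)) :=
  (toPU_eq_iff N _ _).2 (actionMatrix_spec N U u)

theorem nu_ofAdd (u : Fin 2 → ZMod N) : nu N (.ofAdd u) =
    ((⟨weylAt N u, heisenberg_le_clifford N (weyl_mem N _ _)⟩ : clifford N) : ProjClifford N) := rfl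

/-- Conjugation by `g ∈ C̄(N)` acts on the translations `ν u` through `π̄ g`. -/
theorem mul_nu (g : ProjClifford N) (u : Fin 2 → ZMod N) :
    g * nu N (.ofAdd u) = nu N (.ofAdd ((piBar N g).1 *ᵥ u)) * g := by
  obtain ⟨U, rfl⟩ := QuotientGroup.mk_surjective g
  rw [piBar_mk, nu_ofAdd, nu_ofAdd, ← QuotientGroup.mk_mul, ← QuotientGroup.mk_mul,
    projClifford_mk_eq_iff]
  have h := toPU_conj_weylAt N U u
  rw [map_mul, map_inv, mul_inv_eq_iff_eq_mul, ← map_mul] at h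
  exact h

theorem nu_injective : Function.Injective (nu N) := fun u v h =>
  weylAt_phaseEquiv_injective N (u := u.toAdd) (v := v.toAdd) <| (toPU_eq_iff N _ _).1 <|
    (projClifford_mk_eq_iff N _ _).1 h

theorem range_nu : (nu N).range = projHeisenberg N := by
  ext g
  obtain ⟨U, rfl⟩ := QuotientGroup.mk_surjective g
  constructor
  · rintro ⟨u, hu⟩
    rw [← hu]
    exact ⟨⟨weylAt N u.toAdd, heisenberg_le_clifford N (weyl_mem N _ _)⟩, weyl_mem N _ _, rfl⟩
  · rintro ⟨V, hV, hVU⟩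
    obtain ⟨u, hu⟩ := (mem_heisenberg_iff N _).1 hV
    exact ⟨.ofAdd u, by rw [← hVU]; exact (projClifford_mk_eq_iff N _ _).2 hu.symm⟩

/-! ### Schur's lemma and the kernel of `π̄` -/

theorem mul_clock_apply (U : UN N) (i j : ZMod N) :
    (U * clock N).1 i j = U.1 i j * ZMod.toCircle j := by
  simp [clock]

theorem clock_mul_apply (U : UN N) (i j : ZMod N) :
    (clock N * U).1 i j = ZMod.toCircle i * U.1 i j := by
  simp [clock]

theorem mul_shift_apply (U : UN N) (i j : ZMod N) :
    (U * shift N).1 i j = U.1 i (j - 1) := by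
  rw [Matrix.UnitaryGroup.mul_val, Matrix.mul_apply, Finset.sum_eq_single (j - 1)] <;>
    simp +contextual [shift]

theorem shift_mul_apply (U : UN N) (i j : ZMod N) :
    (shift N * U).1 i j = U.1 (i + 1) j := by
  rw [Matrix.UnitaryGroup.mul_val, Matrix.mul_apply, Finset.sum_eq_single (i + 1)]
  · simp [shift]
  · intro k _ hk
    have : i ≠ k - 1 := fun h => hk (by rw [h]; ring)
    simp [shift, this]
  · simp

theorem phase_mul_apply (z : Circle) (U : UN N) (i j : ZMod N) :
    (phase N z * U).1 i j = z * U.1 i j := by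
  simp [phase]

/-- Schur's lemma for the Heisenberg group: a unitary commuting with `X` and `Z` is a phase. -/
theorem mem_phases_of_commute {U : UN N} (hX : U * shift N = shift N * U)
    (hZ : U * clock N = clock N * U) : U ∈ phases N := by
  have hoff : ∀ i j, i ≠ j → U.1 i j = 0 := by
    intro i j hij
    have h := congrFun (congrFun (congrArg Subtype.val hZ) i) j
    rw [mul_clock_apply, clock_mul_apply, mul_comm] at h
    by_contra h0
    exact hij (ZMod.injective_toCircle (Circle.ext (mul_right_cancel₀ h0 h))).symm
  have hdiag : ∀ n : ℕ, U.1 (n : ZMod N) n = U.1 0 0 := by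
    intro n
    induction n with
    | zero => simp
    | succ n ih =>
      have h := congrFun (congrFun (congrArg Subtype.val hX) (n : ZMod N)) (n + 1)
      rw [mul_shift_apply, shift_mul_apply, add_sub_cancel_right, ih] at h
      rw [h]
      push_cast
      rfl
  have hnorm : ‖U.1 0 0‖ = 1 := by
    have h1 := congrFun (congrFun (Matrix.mem_unitaryGroup_iff.1 U.2) 0) 0
    rw [Matrix.mul_apply, Finset.sum_eq_single 0 (fun j _ hj => by rw [hoff 0 j hj.symm, zero_mul])
      (by simp)] at h1
    simp only [Matrix.star_apply, RCLike.star_def, Complex.mul_conj, Matrix.one_apply_eq] at h1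
    rw [Complex.normSq_eq_norm_sq] at h1
    have h2 : ‖U.1 0 0‖ ^ 2 = 1 := by exact_mod_cast h1
    exact (pow_eq_one_iff_of_nonneg (norm_nonneg _) two_ne_zero).1 h2
  refine ⟨⟨U.1 0 0, by simpa [Submonoid.unitSphere] using hnorm⟩, ?_⟩
  apply Subtype.ext
  ext i j
  by_cases h : i = j
  · subst h
    have := hdiag i.val
    rw [ZMod.natCast_zmod_val] at this
    simp [phase, this]
  · simp [phase, h, hoff i j h]

theorem exists_toCircle_of_pow_eq_one {z : Circle} (hz : z ^ N = 1) :
    ∃ a : ZMod N, z = ZMod.toCircle a := by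
  have hzu : Circle.toUnits z ∈ rootsOfUnity N ℂ := by
    rw [mem_rootsOfUnity, ← map_pow, hz, map_one]
  obtain ⟨a, ha⟩ := (surjective_rootsOfUnityCircleEquiv_comp_rootsOfUnityAddChar N) ⟨_, hzu⟩
  refine ⟨a, Circle.ext ?_⟩
  have := congrArg (fun x : rootsOfUnity N ℂ => ((x : ℂˣ) : ℂ)) ha
  simpa using this.symm

/-- If conjugation by `U` multiplies an operator of order dividing `N` by a phase, then that phase
is an `N`-th root of unity. -/
theorem exists_toCircle_of_commute_toPU {U V : UN N} (hV : V ^ N = 1)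
    (h : toPU N (U * V * U⁻¹) = toPU N V) :
    ∃ a : ZMod N, U * V = phase N (ZMod.toCircle a) * (V * U) := by
  obtain ⟨z, hz⟩ := (toPU_eq_iff N _ _).1 h
  have hzN : z ^ N = 1 := by
    have h1 : (U * V * U⁻¹) ^ N = 1 := by rw [conj_pow, hV, mul_one, mul_inv_cancel]
    rw [hz, Commute.mul_pow (phase_comm N z V), hV, mul_one, ← map_pow] at h1
    exact phase_injective N (h1.trans (map_one _).symm)
  obtain ⟨a, rfl⟩ := exists_toCircle_of_pow_eq_one N hzN
  exact ⟨a, by rw [← mul_assoc, ← hz, inv_mul_cancel_right]⟩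

theorem weyl_one_zero : weyl N 1 0 = shift N := by simp [weyl]

theorem weyl_zero_one : weyl N 0 1 = clock N := by simp [weyl]

/-- A unitary which fixes `X` and `Z` modulo phases under conjugation is, modulo phases, a Weyl
operator: multiplying by a suitable Weyl operator makes it commute with `X` and `Z`. -/
theorem exists_weylAt_of_commute_toPU {U : UN N}
    (hX : toPU N (U * shift N * U⁻¹) = toPU N (shift N))
    (hZ : toPU N (U * clock N * U⁻¹) = toPU N (clock N)) :
    ∃ u : Fin 2 → ZMod N, toPU N U = toPU N (weylAt N u) := by
  obtain ⟨a, ha⟩ := exists_toCircle_of_commute_toPU N (shift_pow N) hX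
  obtain ⟨b, hb⟩ := exists_toCircle_of_commute_toPU N (clock_pow N) hZ
  have hp : ∀ (z : Circle) (U V : UN N), U * (phase N z * V) = phase N z * (U * V) := by
    intro z U V; rw [← mul_assoc, ← phase_comm, mul_assoc]
  -- `W = W(-b, a)` commutes with `X` and `Z` up to the phases inverse to those of `U`.
  set W := weyl N (-b.val) a.val with hW
  have hWX : W * shift N = phase N (ZMod.toCircle (-a)) * (shift N * W) := by
    rw [← weyl_one_zero, hW, weyl_mul_weyl]
    simp
  have hWZ : W * clock N = phase N (ZMod.toCircle (-b)) * (clock N * W) := by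
    rw [← weyl_zero_one, hW, weyl_mul_weyl]
    simp
  have h1 : W * U ∈ phases N := by
    apply mem_phases_of_commute
    · rw [mul_assoc, ha, hp, ← mul_assoc W, hWX, mul_assoc, ← mul_assoc, ← map_mul,
        ← AddChar.map_add_eq_mul, add_neg_cancel, AddChar.map_zero_eq_one, map_one, one_mul,
        mul_assoc]
    · rw [mul_assoc, hb, hp, ← mul_assoc W, hWZ, mul_assoc, ← mul_assoc, ← map_mul,
        ← AddChar.map_add_eq_mul, add_neg_cancel, AddChar.map_zero_eq_one, map_one, one_mul,
        mul_assoc]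
  have h2 : toPU N W * toPU N U = 1 := by
    rw [← map_mul]; exact (QuotientGroup.eq_one_iff _).2 h1
  rw [eq_inv_of_mul_eq_one_right h2, ← map_inv]
  exact (mem_heisenberg_iff N _).1 (inv_mem (weyl_mem N _ _))

theorem range_nu_eq_ker_piBar : (nu N).range = (piBar N).ker := by
  ext g
  constructor
  · rintro ⟨v, rfl⟩
    refine (existsUnique_matrix N _).unique (actionMatrix_spec N _) fun u => ?_
    change PhaseEquiv _ (weylAt N ((1 : Matrix (Fin 2) (Fin 2) (ZMod N)) *ᵥ u))
    rw [Matrix.one_mulVec, ← toPU_eq_iff]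
    change toPU N (weylAt N v.toAdd * weylAt N u * (weylAt N v.toAdd)⁻¹) = _
    rw [map_mul, map_mul, ← toPU_weylAt_add N v.toAdd u, add_comm, toPU_weylAt_add, map_inv,
      mul_inv_cancel_right]
  · obtain ⟨U, rfl⟩ := QuotientGroup.mk_surjective g
    intro hU
    have hU1 : cliffordToSL N U = 1 := hU
    have h : ∀ k l : ℤ, toPU N (U * weyl N k l * (U : UN N)⁻¹) = toPU N (weyl N k l) := by
      intro k l
      have h1 := toPU_conj_weylAt N U ![(k : ZMod N), (l : ZMod N)]
      rw [hU1, Matrix.SpecialLinearGroup.coe_one, Matrix.one_mulVec, map_mul, map_mul,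
        toPU_weylAt_cast] at h1
      rwa [map_mul, map_mul]
    obtain ⟨u, hu⟩ := exists_weylAt_of_commute_toPU N (by simpa only [weyl_one_zero] using h 1 0)
      (by simpa only [weyl_zero_one] using h 0 1)
    exact ⟨.ofAdd u, (projClifford_mk_eq_iff N _ _).2 hu.symm⟩

end

section

/-! ### Fourier transform, parity and chirp -/

variable (N : ℕ) [NeZero N]

/-- The discrete Fourier transform, with entries `ω_N ^ (i j) / √N`. -/
noncomputable def fourier : UN N :=
  ⟨Matrix.of fun i j : ZMod N => (ZMod.toCircle (i * j) : ℂ) * (Real.sqrt N : ℂ)⁻¹, by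
    rw [Matrix.mem_unitaryGroup_iff]
    ext i j
    have hN : (N : ℂ) ≠ 0 := Nat.cast_ne_zero.2 (NeZero.ne N)
    have hs : ((Real.sqrt N : ℂ)⁻¹) * (Real.sqrt N : ℂ)⁻¹ = (N : ℂ)⁻¹ := by
      rw [← mul_inv, ← Complex.ofReal_mul, Real.mul_self_sqrt (Nat.cast_nonneg N),
        Complex.ofReal_natCast]
    have h1 : ∀ k : ZMod N, (ZMod.toCircle (i * k) : ℂ) * (Real.sqrt N : ℂ)⁻¹ *
        star ((ZMod.toCircle (j * k) : ℂ) * (Real.sqrt N : ℂ)⁻¹) =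
        ZMod.stdAddChar (k * (i - j)) * (N : ℂ)⁻¹ := by
      intro k
      have h2 : star (ZMod.toCircle (j * k) : ℂ) = ZMod.toCircle (-(j * k)) := by
        rw [AddChar.map_neg_eq_inv, Circle.coe_inv_eq_conj]; rfl
      have h3 : star ((Real.sqrt N : ℂ)⁻¹) = (Real.sqrt N : ℂ)⁻¹ := by simp
      rw [star_mul', h2, h3, mul_mul_mul_comm, hs, ← Circle.coe_mul, ← AddChar.map_add_eq_mul,
        ZMod.stdAddChar_apply]
      congr 3
      ring_nf
    rw [Matrix.mul_apply]
    simp only [Matrix.star_apply, Matrix.of_apply, h1]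
    rw [← Finset.sum_mul, AddChar.sum_mulShift _ (ZMod.isPrimitive_stdAddChar N)]
    by_cases h : i = j
    · subst h
      simp [hN, ZMod.card]
    · simp [h, sub_eq_zero]⟩

/-- The parity operator `|j⟩ ↦ |-j⟩`. -/
noncomputable def parity : UN N :=
  ⟨Matrix.of fun i j : ZMod N => if i = -j then (1 : ℂ) else 0, by
    rw [Matrix.mem_unitaryGroup_iff]
    ext i j
    rw [Matrix.mul_apply, Finset.sum_eq_single (-i)]
    · simp [Matrix.one_apply, eq_comm]
    · intro b _ hb
      have : i ≠ -b := fun h => hb (by rw [h, neg_neg])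
      simp [this]
    · simp⟩

/-- The diagonal unitary with the given phases on the diagonal. -/
noncomputable def diagonalUnitary (f : ZMod N → Circle) : UN N :=
  ⟨Matrix.diagonal fun j => (f j : ℂ), by
    rw [Matrix.mem_unitaryGroup_iff]
    ext i j
    by_cases h : i = j <;>
      simp [Matrix.star_eq_conjTranspose, Matrix.one_apply, h, Complex.mul_conj]⟩

/-- The operator `|j⟩ ↦ exp (-πi j²/N) |j⟩`, computed on representatives `0 ≤ j < N`; for even `N`
any other representative gives the same value. -/
noncomputable def chirp : UN N :=
  diagonalUnitary N fun j => Circle.exp (Real.pi / N) ^ (-(j.val : ℤ) ^ 2)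

variable {N} in
theorem unitary_ext {U V : UN N} (h : ∀ i j, U.1 i j = V.1 i j) : U = V :=
  Subtype.ext (Matrix.ext h)

theorem mul_parity_apply (U : UN N) (i j : ZMod N) : (U * parity N).1 i j = U.1 i (-j) := by
  rw [Matrix.UnitaryGroup.mul_val, Matrix.mul_apply, Finset.sum_eq_single (-j)] <;>
    simp +contextual [parity]

theorem parity_mul_apply (U : UN N) (i j : ZMod N) : (parity N * U).1 i j = U.1 (-i) j := by
  rw [Matrix.UnitaryGroup.mul_val, Matrix.mul_apply, Finset.sum_eq_single (-i)]
  · simp [parity]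
  · intro k _ hk
    have : i ≠ -k := fun h => hk (by rw [h, neg_neg])
    simp [parity, this]
  · simp

theorem fourier_mul_shift : clock N * (fourier N * shift N) = fourier N := by
  refine unitary_ext fun i j => ?_
  rw [clock_mul_apply, mul_shift_apply]
  simp only [fourier, Matrix.of_apply]
  rw [← mul_assoc, ← Circle.coe_mul, ← AddChar.map_add_eq_mul]
  ring_nf

theorem fourier_mul_clock : fourier N * clock N = shift N * fourier N := by
  refine unitary_ext fun i j => ?_
  rw [mul_clock_apply, shift_mul_apply]
  simp only [fourier, Matrix.of_apply]
  rw [mul_right_comm, ← Circle.coe_mul, ← AddChar.map_add_eq_mul]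
  ring_nf

theorem parity_mul_shift : shift N * (parity N * shift N) = parity N := by
  refine unitary_ext fun i j => ?_
  rw [shift_mul_apply, mul_shift_apply]
  have : i + 1 = -(j - 1) ↔ i = -j := by
    rw [neg_sub, sub_eq_neg_add, add_left_inj]
  simp only [parity, Matrix.of_apply, this]

theorem parity_mul_clock : clock N * (parity N * clock N) = parity N := by
  refine unitary_ext fun i j => ?_
  rw [clock_mul_apply, mul_clock_apply]
  by_cases h : i = -j
  · simp [parity, h, ← Circle.coe_mul, ← AddChar.map_add_eq_mul]
  · simp [parity, h]

theorem chirp_mul_clock : chirp N * clock N = clock N * chirp N := by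
  refine unitary_ext fun i j => ?_
  rw [clock_mul_apply, mul_clock_apply]
  by_cases h : i = j
  · simp [h, mul_comm]
  · simp [chirp, diagonalUnitary, h]

theorem exp_pi_div_zpow_two_mul (m : ℤ) :
    Circle.exp (Real.pi / N) ^ (2 * m) = ZMod.toCircle (m : ZMod N) := by
  have h : Circle.exp (Real.pi / N) ^ (2 : ℤ) = ZMod.toCircle (1 : ZMod N) := by
    apply Circle.ext
    have := ZMod.toCircle_intCast (N := N) 1
    rw [Int.cast_one] at this
    rw [this, zpow_ofNat, ← Circle.exp_nsmul, Circle.coe_exp]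
    congr 1
    push_cast
    ring
  rw [zpow_mul, h, ← AddChar.map_zsmul_eq_zpow, zsmul_one]

theorem exp_pi_div_zpow (m : ℤ) : Circle.exp (Real.pi / N) ^ (N * m : ℤ) = (-1) ^ m := by
  have h : Circle.exp (Real.pi / N) ^ (N : ℤ) = -1 := by
    have hN : (N : ℝ) ≠ 0 := Nat.cast_ne_zero.2 (NeZero.ne N)
    rw [zpow_natCast, ← Circle.exp_nsmul, nsmul_eq_mul, mul_div_cancel₀ _ hN]
    exact Circle.ext (by simp [Circle.coe_exp])
  rw [zpow_mul, h]

variable {N}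

/-- For even `N`, `exp (-πi k²/N)` depends only on `k` modulo `N`. -/
theorem exp_pi_div_zpow_neg_sq_congr (hN : Even N) {k l : ℤ} (h : (k : ZMod N) = l) :
    Circle.exp (Real.pi / N) ^ (-k ^ 2) = Circle.exp (Real.pi / N) ^ (-l ^ 2) := by
  obtain ⟨c, hc⟩ := (ZMod.intCast_eq_intCast_iff_dvd_sub _ _ _).1 h
  obtain ⟨M, hM⟩ := hN
  have hM' : (N : ℤ) = M + M := by exact_mod_cast hM
  have e : -l ^ 2 = -k ^ 2 + N * (2 * (-(c * k + M * c ^ 2))) := by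
    rw [show l = k + N * c by omega, hM']; ring
  rw [e, zpow_add, exp_pi_div_zpow, zpow_mul, zpow_ofNat, neg_one_sq, one_zpow, mul_one]

theorem chirp_apply (hN : Even N) (k : ℤ) {j : ZMod N} (h : (k : ZMod N) = j) :
    (chirp N).1 j j = (Circle.exp (Real.pi / N) ^ (-k ^ 2) : Circle) := by
  rw [exp_pi_div_zpow_neg_sq_congr hN (l := j.val) (by simp [h])]
  simp [chirp, diagonalUnitary]

theorem chirp_apply_ne {i j : ZMod N} (h : i ≠ j) : (chirp N).1 i j = 0 := by
  simp [chirp, diagonalUnitary, h]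

theorem chirp_mul_shift (hN : Even N) : chirp N * shift N =
    phase N (Circle.exp (Real.pi / N)) * (clock N * (shift N * chirp N)) := by
  refine unitary_ext fun i j => ?_
  rw [mul_shift_apply, phase_mul_apply, clock_mul_apply, shift_mul_apply]
  by_cases h : i = j - 1
  · have hj : j = i + 1 := by rw [h]; ring
    subst hj
    have hi : ZMod.toCircle i = Circle.exp (Real.pi / N) ^ (2 * (i.val : ℤ)) := by
      rw [exp_pi_div_zpow_two_mul]; simp
    rw [add_sub_cancel_right, chirp_apply hN i.val (j := i) (by simp),
      chirp_apply hN (i.val + 1) (j := i + 1) (by simp), hi, ← Circle.coe_mul, ← Circle.coe_mul,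
      ← zpow_add, ← zpow_one_add]
    congr 2
    ring
  · rw [chirp_apply_ne h, chirp_apply_ne fun h' => h (eq_sub_of_add_eq h'), mul_zero, mul_zero]

theorem chirp_mul_parity (hN : Even N) : chirp N * parity N = parity N * chirp N := by
  refine unitary_ext fun i j => ?_
  rw [mul_parity_apply, parity_mul_apply]
  by_cases h : i = -j
  · rw [h, neg_neg, chirp_apply hN j.val (j := j) (by simp),
      chirp_apply hN (-j.val) (j := -j) (by simp), neg_sq]
  · rw [chirp_apply_ne h, chirp_apply_ne fun h' => h (neg_eq_iff_eq_neg.1 h')]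

theorem chirp_pow (hN : Even N) : chirp N ^ N = clock N ^ (N / 2) := by
  refine Subtype.ext ?_
  change (Matrix.diagonal _) ^ N = (Matrix.diagonal _) ^ (N / 2)
  rw [Matrix.diagonal_pow, Matrix.diagonal_pow]
  congr 1
  funext j
  simp only [Pi.pow_apply]
  obtain ⟨M, hM⟩ := hN
  have hM2 : N / 2 = M := by omega
  rw [← Circle.coe_pow, ← Circle.coe_pow]
  congr 1
  have h1 : ZMod.toCircle j = Circle.exp (Real.pi / N) ^ (2 * (j.val : ℤ)) := by
    rw [exp_pi_div_zpow_two_mul]; simp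
  have hN' : (N : ℤ) = M + M := by exact_mod_cast hM
  rw [hM2, h1, ← zpow_natCast, ← zpow_natCast, ← zpow_mul, ← zpow_mul,
    show 2 * (j.val : ℤ) * (M : ℤ) = N * j.val by rw [hN']; ring,
    mul_comm _ (N : ℤ), exp_pi_div_zpow, exp_pi_div_zpow]
  rcases Int.even_or_odd (j.val : ℤ) with h | h
  · rw [h.neg_one_zpow, (h.pow_of_ne_zero two_ne_zero).neg.neg_one_zpow]
  · rw [h.neg_one_zpow, h.pow.neg.neg_one_zpow]

end

section

/-! ### Generators of `SL(2, ℤ_N)` -/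

variable {N : ℕ} [NeZero N]

/-- The lower unitriangular matrix with entry `t`. -/
def lowerSL {R : Type*} [CommRing R] (t : R) : Matrix.SpecialLinearGroup (Fin 2) R :=
  ⟨!![1, 0; t, 1], by simp⟩

/-- The upper unitriangular matrix with entry `t`. -/
def upperSL {R : Type*} [CommRing R] (t : R) : Matrix.SpecialLinearGroup (Fin 2) R :=
  ⟨!![1, t; 0, 1], by simp⟩

/-- The quarter turn `(x, y) ↦ (y, -x)`. -/
def rotSL (R : Type*) [CommRing R] : Matrix.SpecialLinearGroup (Fin 2) R :=
  ⟨!![0, 1; -1, 0], by simp⟩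

theorem coe_lowerSL {R : Type*} [CommRing R] (t : R) : (lowerSL t).1 = !![1, 0; t, 1] := rfl

theorem coe_upperSL {R : Type*} [CommRing R] (t : R) : (upperSL t).1 = !![1, t; 0, 1] := rfl

theorem coe_rotSL (R : Type*) [CommRing R] : (rotSL R).1 = !![0, 1; -1, 0] := rfl

theorem lowerSL_add {R : Type*} [CommRing R] (s t : R) :
    lowerSL (s + t) = lowerSL s * lowerSL t := by
  apply Subtype.ext
  simp [coe_lowerSL]

theorem lowerSL_zero {R : Type*} [CommRing R] : lowerSL (0 : R) = 1 := by
  apply Subtype.ext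
  simp [lowerSL, Matrix.one_fin_two]

theorem lowerSL_pow {R : Type*} [CommRing R] (t : R) (n : ℕ) :
    lowerSL t ^ n = lowerSL (n * t) := by
  induction n with
  | zero => simp [lowerSL_zero]
  | succ n ih => rw [pow_succ, ih, ← lowerSL_add]; push_cast; ring_nf

theorem upperSL_eq_conj {R : Type*} [CommRing R] (t : R) :
    upperSL t = rotSL R * lowerSL (-t) * (rotSL R)⁻¹ := by
  rw [eq_mul_inv_iff_mul_eq]
  apply Subtype.ext
  simp [coe_upperSL, coe_lowerSL, coe_rotSL]

/-- `SL(2, ℤ_N)` is generated by a quarter turn and an elementary matrix: Euclid's algorithm on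
the first column, run on representatives in `{0, …, N-1}`. -/
theorem eq_top_of_rotSL_mem_of_lowerSL_mem {K : Subgroup (Matrix.SpecialLinearGroup (Fin 2) (ZMod N))}
    (hS : rotSL (ZMod N) ∈ K) (hT : lowerSL 1 ∈ K) : K = ⊤ := by
  have hL : ∀ t : ZMod N, lowerSL t ∈ K := by
    intro t
    have := K.pow_mem hT t.val
    rwa [lowerSL_pow, ZMod.natCast_zmod_val, mul_one] at this
  have hU : ∀ t : ZMod N, upperSL t ∈ K := by
    intro t
    rw [upperSL_eq_conj]
    exact K.mul_mem (K.mul_mem hS (hL _)) (K.inv_mem hS)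
  have key : ∀ (n : ℕ) (A : Matrix.SpecialLinearGroup (Fin 2) (ZMod N)),
      (A.1 1 0).val = n → A ∈ K := by
    intro n
    induction n using Nat.strong_induction_on with
    | _ n ih =>
      intro A hA
      rcases Nat.eq_zero_or_pos n with rfl | hn
      · -- Here `A = (a, b; 0, d)` with `a d = 1`; three row operations turn the column `(a, 0)`
        -- into `(a, 1)`, `(1, 1)`, `(1, 0)`.
        have hc : A.1 1 0 = 0 := (ZMod.val_eq_zero _).1 hA
        have hdet : A.1 0 0 * A.1 1 1 = 1 := by
          have := A.2
          rwa [Matrix.det_fin_two, hc, mul_zero, sub_zero] at this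
        have h1 : lowerSL (-1) * (upperSL (1 - A.1 0 0) * (lowerSL (A.1 1 1) * A)) =
            upperSL (A.1 0 1 + (1 - A.1 0 0) * (A.1 1 1 * A.1 0 1 + A.1 1 1)) := by
          apply Subtype.ext
          rw [Matrix.SpecialLinearGroup.coe_mul, Matrix.SpecialLinearGroup.coe_mul,
            Matrix.SpecialLinearGroup.coe_mul, coe_lowerSL, coe_lowerSL, coe_upperSL, coe_upperSL]
          nth_rewrite 3 [Matrix.eta_fin_two A.1]
          simp only [hc, Matrix.mul_fin_two]
          congr 1
          ext i j
          fin_cases i <;> fin_cases j <;> simp <;> grind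
        have h2 : A = (lowerSL (A.1 1 1))⁻¹ * ((upperSL (1 - A.1 0 0))⁻¹ * ((lowerSL (-1))⁻¹ *
            upperSL (A.1 0 1 + (1 - A.1 0 0) * (A.1 1 1 * A.1 0 1 + A.1 1 1)))) := by
          rw [← h1]; group
        rw [h2]
        exact K.mul_mem (K.inv_mem (hL _)) (K.mul_mem (K.inv_mem (hU _))
          (K.mul_mem (K.inv_mem (hL _)) (hU _)))
      · have hB := ih ((A.1 0 0).val % n) (Nat.mod_lt _ hn)
          ((rotSL (ZMod N))⁻¹ * (upperSL (-(((A.1 0 0).val / n : ℕ) : ZMod N)) * A)) (by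
            have hent : ((rotSL (ZMod N))⁻¹ *
                (upperSL (-(((A.1 0 0).val / n : ℕ) : ZMod N)) * A)).1 1 0 =
                (((A.1 0 0).val % n : ℕ) : ZMod N) := by
              have h1 : A.1 0 0 = ((n * ((A.1 0 0).val / n) + (A.1 0 0).val % n : ℕ) : ZMod N) := by
                rw [Nat.div_add_mod, ZMod.natCast_zmod_val]
              have h2 : A.1 1 0 = (n : ZMod N) := by rw [← hA, ZMod.natCast_zmod_val]
              have h3 : ((rotSL (ZMod N))⁻¹ *
                (upperSL (-(((A.1 0 0).val / n : ℕ) : ZMod N)) * A)).1 1 0 =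
                  A.1 0 0 - (((A.1 0 0).val / n : ℕ) : ZMod N) * A.1 1 0 := by
                simp [coe_rotSL, coe_upperSL, Matrix.SpecialLinearGroup.coe_inv, Matrix.adjugate_fin_two,
                  Matrix.mul_apply, Fin.sum_univ_two, sub_eq_add_neg,
                  Matrix.vecMul, dotProduct]
              rw [h3, h2]
              nth_rewrite 1 [h1]
              push_cast
              ring
            rw [hent, ZMod.val_natCast, Nat.mod_eq_of_lt]
            exact (Nat.mod_lt _ hn).trans (hA ▸ ZMod.val_lt _))
        exact (K.mul_mem_cancel_left (hU _)).1 ((K.mul_mem_cancel_left (K.inv_mem hS)).1 hB)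
  exact eq_top_iff.2 fun A _ => key _ A rfl

end

section

/-! ### Surjectivity of `π̄` -/

variable (N : ℕ) [NeZero N]

theorem fourier_clifford : ∃ h : fourier N ∈ clifford N,
    cliffordToSL N ⟨fourier N, h⟩ = rotSL (ZMod N) := by
  refine exists_clifford_of_generators N (a := 0) (b := 1) (c := -1) (d := 0)
    (by simp [coe_rotSL]) ?_ ?_
  · rw [zpow_zero, one_mul, zpow_neg_one, eq_inv_mul_iff_mul_eq, ← map_mul, ← map_mul,
      fourier_mul_shift]
  · rw [zpow_zero, mul_one, zpow_one, ← map_mul, ← map_mul, fourier_mul_clock]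

theorem parity_clifford : ∃ h : parity N ∈ clifford N, cliffordToSL N ⟨parity N, h⟩ = -1 := by
  refine exists_clifford_of_generators N (a := -1) (b := 0) (c := 0) (d := -1)
    (by simp [Matrix.one_fin_two]) ?_ ?_
  · rw [zpow_zero, mul_one, zpow_neg_one, eq_inv_mul_iff_mul_eq, ← map_mul, ← map_mul,
      parity_mul_shift]
  · rw [zpow_zero, one_mul, zpow_neg_one, eq_inv_mul_iff_mul_eq, ← map_mul, ← map_mul,
      parity_mul_clock]

variable {N}

theorem chirp_clifford (hN : Even N) : ∃ h : chirp N ∈ clifford N,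
    cliffordToSL N ⟨chirp N, h⟩ = lowerSL 1 := by
  refine exists_clifford_of_generators N (a := 1) (b := 0) (c := 1) (d := 1)
    (by simp [coe_lowerSL]) ?_ ?_
  · rw [zpow_one, zpow_one, (toPU_comm N).eq, ← map_mul, chirp_mul_shift hN, map_mul, toPU_phase,
      one_mul, map_mul, map_mul, mul_assoc]
  · rw [zpow_zero, one_mul, zpow_one, ← map_mul, ← map_mul, chirp_mul_clock]

theorem piBar_surjective (hN : Even N) : Function.Surjective (piBar N) := by
  rw [← MonoidHom.range_eq_top]
  apply eq_top_of_rotSL_mem_of_lowerSL_mem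
  · obtain ⟨h, hF⟩ := fourier_clifford N
    exact ⟨((⟨fourier N, h⟩ : clifford N) : ProjClifford N), hF⟩
  · obtain ⟨h, hD⟩ := chirp_clifford hN
    exact ⟨((⟨chirp N, h⟩ : clifford N) : ProjClifford N), hD⟩

/-! ### Absence of a section -/

theorem exists_nu_mul_of_piBar_eq {g h : ProjClifford N} (hgh : piBar N g = piBar N h) :
    ∃ u : Fin 2 → ZMod N, g = nu N (.ofAdd u) * h := by
  have h1 : g * h⁻¹ ∈ (nu N).range := by
    rw [range_nu_eq_ker_piBar, MonoidHom.mem_ker, map_mul, map_inv, hgh, mul_inv_cancel]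
  obtain ⟨u, hu⟩ := h1
  exact ⟨u.toAdd, by rw [ofAdd_toAdd, hu, inv_mul_cancel_right]⟩

theorem nu_mul_nu_mul (u v : Fin 2 → ZMod N) (g : ProjClifford N) :
    nu N (.ofAdd u) * (nu N (.ofAdd v) * g) = nu N (.ofAdd (u + v)) * g := by
  rw [ofAdd_add, map_mul, mul_assoc]

/-- Powers of a lift `ν u * d` of the elementary matrix `T`: the translation part of the `n`-th
power is `∑ i < n, T ^ i u`. -/
theorem nu_mul_pow {d : ProjClifford N} (hd : piBar N d = lowerSL 1) (u : Fin 2 → ZMod N) (n : ℕ) :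
    (nu N (.ofAdd u) * d) ^ n =
      nu N (.ofAdd ![n * u 0, n * u 1 + n.choose 2 * u 0]) * d ^ n := by
  induction n with
  | zero =>
    have h0 : (![0, 0] : Fin 2 → ZMod N) = 0 := by ext i; fin_cases i <;> rfl
    simp [h0]
  | succ n ih =>
    rw [pow_succ', ih, mul_assoc, ← mul_assoc d, mul_nu, mul_assoc, nu_mul_nu_mul, ← pow_succ', hd,
      coe_lowerSL]
    congr 3
    ext i
    fin_cases i
    · simp [Nat.choose_succ_succ]; ring
    · simp [Nat.choose_succ_succ]; ring

/-- For `4 ∣ N` the homomorphism `π̄` has no section. A lift `ν u * d` of `T` has order dividing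
`N` only if `N / 2 + (N choose 2) u₀ = 0`, and it commutes with a lift of `-1` only if `2 u₀ = 0`,
which makes `(N choose 2) u₀` vanish. -/
theorem not_exists_section_piBar (hN : 4 ∣ N) :
    ¬ ∃ μ : Matrix.SpecialLinearGroup (Fin 2) (ZMod N) →* ProjClifford N,
      (piBar N).comp μ = MonoidHom.id _ := by
  rintro ⟨μ, hμ⟩
  obtain ⟨M, hNM⟩ := hN
  have hM : M ≠ 0 := by rintro rfl; exact NeZero.ne N (by omega)
  have hE : Even N := ⟨2 * M, by omega⟩
  obtain ⟨hd, hdT⟩ := chirp_clifford hE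
  obtain ⟨hp, hpI⟩ := parity_clifford N
  set d : ProjClifford N := ((⟨chirp N, hd⟩ : clifford N) : ProjClifford N) with hd_def
  set p : ProjClifford N := ((⟨parity N, hp⟩ : clifford N) : ProjClifford N) with hp_def
  have hd1 : piBar N d = lowerSL 1 := hdT
  have hp1 : piBar N p = -1 := hpI
  have hdp : d * p = p * d := by
    rw [hd_def, hp_def, ← QuotientGroup.mk_mul, ← QuotientGroup.mk_mul]
    exact congrArg _ (Subtype.ext (chirp_mul_parity hE))
  have hdN : d ^ N = nu N (.ofAdd ![0, (2 * M : ℕ)]) := by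
    rw [hd_def, ← QuotientGroup.mk_pow, nu_ofAdd, projClifford_mk_eq_iff]
    have h1 := toPU_weylAt_cast N 0 (2 * M : ℕ)
    rw [Int.cast_zero, Int.cast_natCast] at h1
    rw [h1, toPU_weyl, zpow_zero, one_mul, zpow_natCast, ← map_pow, Subgroup.coe_pow]
    change toPU N (chirp N ^ N) = _
    rw [chirp_pow hE]
    congr 2
    omega
  have hμ' : ∀ A, piBar N (μ A) = A := fun A => DFunLike.congr_fun hμ A
  obtain ⟨u, hu⟩ := exists_nu_mul_of_piBar_eq ((hμ' (lowerSL 1)).trans hd1.symm)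
  obtain ⟨w, hw⟩ := exists_nu_mul_of_piBar_eq ((hμ' (-1)).trans hp1.symm)
  -- The lift of `T` has order dividing `N`.
  have horder : ((2 * M : ℕ) : ZMod N) + (N.choose 2 : ℕ) * u 0 = 0 := by
    have h1 : μ (lowerSL 1) ^ N = 1 := by
      rw [← map_pow, lowerSL_pow, ZMod.natCast_self, zero_mul, lowerSL_zero, map_one]
    rw [hu, nu_mul_pow hd1, hdN, ← map_mul, ← ofAdd_add] at h1
    have h2 := congrFun (congrArg Multiplicative.toAdd (nu_injective N (h1.trans (map_one _).symm))) 1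
    simpa [add_comm] using h2
  -- The lifts of `T` and `-1` commute.
  have hcomm : 2 * u 0 = 0 := by
    have h1 : μ (lowerSL 1) * μ (-1) = μ (-1) * μ (lowerSL 1) := by
      rw [← map_mul, ← map_mul, mul_neg_one, neg_one_mul]
    rw [hu, hw, mul_assoc, ← mul_assoc d, mul_nu, mul_assoc, nu_mul_nu_mul, hdp,
      mul_assoc (nu N (.ofAdd w)), ← mul_assoc p, mul_nu, mul_assoc _ p, nu_mul_nu_mul] at h1
    have h2 := congrFun (congrArg Multiplicative.toAdd (nu_injective N (mul_right_cancel h1))) 0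
    rw [hd1, hp1, coe_lowerSL] at h2
    have h3 : u 0 + w 0 = w 0 + -u 0 := by simpa [Matrix.vecHead] using h2
    linear_combination h3
  have hchoose : ((N.choose 2 : ℕ) : ZMod N) * u 0 = 0 := by
    have h1 : N.choose 2 = M * (N - 1) * 2 := by
      rw [Nat.choose_two_right, hNM, show 4 * M * (4 * M - 1) = 2 * (M * (4 * M - 1) * 2) by ring,
        Nat.mul_div_cancel_left _ two_pos]
    rw [h1, Nat.cast_mul, Nat.cast_two, mul_assoc, hcomm, mul_zero]
  rw [hchoose, add_zero, ZMod.natCast_eq_zero_iff] at horder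
  exact absurd (Nat.le_of_dvd (by omega) horder) (by omega)

end

/-! ### Splittings of group extensions -/

theorem IsSemidirectFor.isRightSplitting {H G K : Type*} [Group H] [Group G] [Group K]
    {S : GroupExtension H G K} (h : IsSemidirectFor S) : IsRightSplitting S := by
  obtain ⟨φ, Φ, -, hΦ⟩ := h
  exact ⟨Φ.toMonoidHom.comp SemidirectProduct.inr, MonoidHom.ext hΦ⟩

/-- A surjection with the same kernel as the quotient map of a group extension splits as soon as
the extension does. -/
theorem IsRightSplitting.exists_section {H G K L : Type*} [Group H] [Group G] [Group K] [Group L]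
    {S : GroupExtension H G K} (h : IsRightSplitting S) {f : G →* L} (hf : Function.Surjective f)
    (hker : S.rightHom.ker = f.ker) : ∃ μ : L →* G, f.comp μ = MonoidHom.id L := by
  obtain ⟨μ, hμ⟩ := h
  let q : L →* K := f.liftOfSurjective hf ⟨S.rightHom, hker.ge⟩
  have hq : ∀ g, q (f g) = S.rightHom g := fun g =>
    f.liftOfRightInverse_comp_apply _ (Function.rightInverse_surjInv hf) ⟨S.rightHom, hker.ge⟩ g
  refine ⟨μ.comp q, MonoidHom.ext fun x => ?_⟩
  obtain ⟨g, rfl⟩ := hf x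
  have h1 : S.rightHom (μ (S.rightHom g)) = S.rightHom g := DFunLike.congr_fun hμ _
  simp only [MonoidHom.comp_apply, MonoidHom.id_apply, hq]
  rw [← inv_mul_eq_one, ← map_inv, ← map_mul, ← MonoidHom.mem_ker, ← hker, MonoidHom.mem_ker,
    map_mul, map_inv, h1, inv_mul_cancel]

end CliffordGroup

theorem theorem6p1 (N : ℕ) [NeZero N] (hN : N ≡ 0 [MOD 4]) :
    (¬ CliffordGroup.IsSemidirectFor (CliffordGroup.quotientExtension N) ∧
      ¬ CliffordGroup.IsRightSplitting (CliffordGroup.quotientExtension N)) ∧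
    (CliffordGroup.nu N).range = CliffordGroup.projHeisenberg N ∧
    ∃ S : GroupExtension (Multiplicative (Fin 2 → ZMod N)) (CliffordGroup.ProjClifford N)
        (Matrix.SpecialLinearGroup (Fin 2) (ZMod N)),
      S.inl = CliffordGroup.nu N ∧ S.rightHom = CliffordGroup.piBar N ∧
      ¬ CliffordGroup.IsSemidirectFor S ∧ ¬ CliffordGroup.IsRightSplitting S := by
  have h4 : 4 ∣ N := (Nat.modEq_zero_iff_dvd).1 hN
  have hE : Even N := even_iff_two_dvd.2 (dvd_trans (by norm_num) h4)
  have hsurj := CliffordGroup.piBar_surjective hE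
  have hno := CliffordGroup.not_exists_section_piBar h4
  have hker : (CliffordGroup.quotientExtension N).rightHom.ker = (CliffordGroup.piBar N).ker := by
    rw [← CliffordGroup.range_nu_eq_ker_piBar, CliffordGroup.range_nu]
    exact QuotientGroup.ker_mk' _
  have hq : ¬ CliffordGroup.IsRightSplitting (CliffordGroup.quotientExtension N) :=
    fun h => hno (h.exists_section hsurj hker)
  refine ⟨⟨fun h => hq h.isRightSplitting, hq⟩, CliffordGroup.range_nu N,
    { inl := CliffordGroup.nu N
      rightHom := CliffordGroup.piBar N
      inl_injective := CliffordGroup.nu_injective N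
      range_inl_eq_ker_rightHom := CliffordGroup.range_nu_eq_ker_piBar N
      rightHom_surjective := hsurj }, rfl, rfl, fun h => hno h.isRightSplitting, hno⟩
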